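/- Let $G$ be a connected finite simple graph with $n$ vertices, and let $d_{\max}$ be its maximum degree. Consider the simple random walk on $G$, which at each step moves from the current vertex $v$ to a neighbour of $v$ chosen uniformly at random (on the one-vertex graph the walk stays put). For vertices $x,y$ let $H(x,y)\in[0,\infty]$ be the hitting time, i.e. the expected value of the first time $t\ge 0$ at which the walk started at $x$ is at $y$; in particular $H(x,x)=0$. Then for all vertices $x,y$ of $G$: $$H(x,y)\le d_{\max}\,(n-1)^2,\qquad H(x,y)\le (n-1)^3,$$ and if $k\geq 0$ is a real number such that every vertex of $G$ has degree at most $k$, then $$H(x,y)\le k\,(n-1)^2.$$ -/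

import Mathlib

open MeasureTheory ProbabilityTheory
open scoped ENNReal NNReal

noncomputable section

namespace GraphWalk

variable {V : Type*} [Fintype V] (G : SimpleGraph V) [DecidableRel G.Adj]

/-- Law of one step of the simple random walk at the vertex `v`: the uniform distribution on the
neighbours of `v`. A vertex without neighbours (for a connected graph this only happens for the
one-vertex graph) is absorbing. -/
def stepPMF (v : V) : PMF V :=
  if h : (G.neighborFinset v).Nonempty then PMF.uniformOfFinset (G.neighborFinset v) h
  else PMF.pure v

variable [MeasurableSpace V] [MeasurableSingletonClass V]

/-- The one-step transition kernel of the simple random walk. -/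
def stepKernel : Kernel V V :=
  Kernel.ofFunOfCountable fun v => (stepPMF G v).toMeasure

instance : IsMarkovKernel (stepKernel G) :=
  ⟨fun v => inferInstanceAs (IsProbabilityMeasure (stepPMF G v).toMeasure)⟩

/-- The transition kernel from the history `(ω 0, …, ω n)` of the walk to its next position
`ω (n + 1)`; it only depends on the present position `ω n`. -/
def historyKernel (n : ℕ) : Kernel (Π _ : Finset.Iic n, V) V :=
  (stepKernel G).comap (fun h => h ⟨n, Finset.mem_Iic.2 le_rfl⟩) (measurable_pi_apply _)

instance (n : ℕ) : IsMarkovKernel (historyKernel G n) := by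
  unfold historyKernel; infer_instance

/-- The law, on the space `ℕ → V` of infinite trajectories, of the simple random walk on `G`
started at `x`. -/
def walkLaw (x : V) : Measure (ℕ → V) :=
  Kernel.traj (X := fun _ => V) (historyKernel G) 0 (fun _ => x)

/-- The first time `n ≥ 0` at which the trajectory `ω` is at `y` (`⊤` if it never is). -/
def firstVisit {V : Type*} (y : V) (ω : ℕ → V) : ℕ∞ :=
  hittingAfter (fun (n : ℕ) (ω : ℕ → V) => ω n) {y} 0 ω

/-- The hitting time `H(x, y)`: the expected number of steps that the simple random walk on `G`
started at `x` takes to reach `y`, as an element of `[0, ∞]`. -/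
def hittingTime (x y : V) : ℝ≥0∞ :=
  ∫⁻ ω, (firstVisit y ω : ℝ≥0∞) ∂(walkLaw G x)

end GraphWalk

end

namespace GraphWalk

/-! Read `h = H(·, y)` as a potential: off `y` its net outflow `∑ (h z - h w)` over neighbours `w`
is at most `deg z`. Over a superlevel set missing `y`, inner flows cancel and all boundary flows are
nonnegative, so one edge carries at most `(n - 1) * D` (`sub_le_of_adj_of_subharmonic`). A path to
`y` has at most `n - 1` edges, whence `D * (n - 1) ^ 2`.

Finiteness of `H` is not known beforehand, so the argument is run on the truncations `∑ n < N,
survival G y n`, with a bound uniform in `N`; truncating costs only equality in the one-step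
equation. -/

/-- If every vertex other than a minimiser `y` of `h` satisfies `h v ≤ 1 + (average of h over the
neighbours of v)`, then `h` changes along each edge by at most `(card V - 1) * D`, where `D` bounds
the degrees. -/
theorem sub_le_of_adj_of_subharmonic {V : Type*} [Fintype V] (G : SimpleGraph V)
    [DecidableRel G.Adj] {D : ℕ} (hD : ∀ v, G.degree v ≤ D) {h : V → ℝ} {y : V}
    (hy : ∀ v, h y ≤ h v)
    (hsub : ∀ v, v ≠ y → G.degree v * h v ≤ G.degree v + ∑ w ∈ G.neighborFinset v, h w)
    {u v : V} (huv : G.Adj u v) :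
    h u - h v ≤ ((Fintype.card V - 1 : ℕ) : ℝ) * D := by
  classical
  rcases le_or_gt (h u) (h v) with hle | hlt
  · have : (0 : ℝ) ≤ ((Fintype.card V - 1 : ℕ) : ℝ) * D := by positivity
    linarith
  -- The minimiser `y` is outside `S`, so `hsub` holds throughout `S` and `S` has at most `n - 1`
  -- elements.
  set S : Finset V := Finset.univ.filter fun z => h v < h z with hS
  have mem_S : ∀ z, z ∈ S ↔ h v < h z := fun z => by simp [hS]
  let f : V → V → ℝ := fun z w => if G.Adj z w then h z - h w else 0
  have hyS : y ∉ S := fun hyS => absurd ((mem_S y).1 hyS) (not_lt.2 (hy v))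
  have hcard : S.card ≤ Fintype.card V - 1 := by
    have := Finset.card_lt_univ_of_notMem hyS
    omega
  have upper : ∑ z ∈ S, ∑ w, f z w ≤ ((Fintype.card V - 1 : ℕ) : ℝ) * D := by
    have hz : ∀ z ∈ S, ∑ w, f z w ≤ D := by
      intro z hz
      have hzy : z ≠ y := fun e => hyS (e ▸ hz)
      have e : ∑ w, f z w = G.degree z * h z - ∑ w ∈ G.neighborFinset z, h w := by
        simp only [f, ← Finset.sum_filter, Finset.sum_sub_distrib, Finset.sum_const,
          nsmul_eq_mul, ← SimpleGraph.neighborFinset_eq_filter, SimpleGraph.card_neighborFinset_eq_degree]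
      have hd : (G.degree z : ℝ) ≤ D := by exact_mod_cast hD z
      linarith [hsub z hzy]
    calc ∑ z ∈ S, ∑ w, f z w ≤ ∑ _z ∈ S, (D : ℝ) := Finset.sum_le_sum hz
      _ = S.card * D := by simp
      _ ≤ _ := by gcongr
  have inner : ∑ z ∈ S, ∑ w ∈ S, f z w = 0 := by
    have anti : ∀ z w, f z w = - f w z := by
      intro z w
      by_cases hzw : G.Adj z w
      · simp [f, hzw, hzw.symm]
      · simp [f, G.adj_comm w z, hzw]
    have : ∑ z ∈ S, ∑ w ∈ S, f z w = - ∑ z ∈ S, ∑ w ∈ S, f z w := by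
      conv_lhs => rw [Finset.sum_comm]
      simp_rw [← Finset.sum_neg_distrib]
      exact Finset.sum_congr rfl fun z _ => Finset.sum_congr rfl fun w _ => anti w z
    linarith
  have split : ∑ z ∈ S, ∑ w, f z w = ∑ z ∈ S, ∑ w ∈ Sᶜ, f z w := by
    simp_rw [← Finset.sum_add_sum_compl S, Finset.sum_add_distrib]
    rw [inner, zero_add]
  have nonneg : ∀ z ∈ S, ∀ w ∈ Sᶜ, 0 ≤ f z w := by
    intro z hz w hw
    have h1 := (mem_S z).1 hz
    have h2 := not_lt.1 (fun hh => Finset.mem_compl.1 hw ((mem_S w).2 hh))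
    simp only [f]
    split_ifs
    · linarith
    · exact le_rfl
  have huS : u ∈ S := (mem_S u).2 hlt
  have hvS : v ∈ Sᶜ := Finset.mem_compl.2 fun hv => lt_irrefl _ ((mem_S v).1 hv)
  calc h u - h v = f u v := by simp [f, huv]
    _ ≤ ∑ w ∈ Sᶜ, f u w := Finset.single_le_sum (nonneg u huS) hvS
    _ ≤ ∑ z ∈ S, ∑ w ∈ Sᶜ, f z w :=
      Finset.single_le_sum (fun z hz => Finset.sum_nonneg (nonneg z hz)) huS
    _ ≤ _ := split ▸ upper

theorem le_of_subharmonic {V : Type*} [Fintype V] (G : SimpleGraph V) [DecidableRel G.Adj]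
    (hG : G.Connected) {D : ℕ} (hD : ∀ v, G.degree v ≤ D) {h : V → ℝ} {y : V}
    (hy : h y = 0) (h0 : ∀ v, 0 ≤ h v)
    (hsub : ∀ v, v ≠ y → G.degree v * h v ≤ G.degree v + ∑ w ∈ G.neighborFinset v, h w)
    (x : V) :
    h x ≤ D * ((Fintype.card V - 1 : ℕ) : ℝ) ^ 2 := by
  classical
  have hmin : ∀ v, h y ≤ h v := fun v => hy ▸ h0 v
  have walk : ∀ {u v : V} (p : G.Walk u v),
      h u - h v ≤ p.length * (((Fintype.card V - 1 : ℕ) : ℝ) * D) := by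
    intro u v p
    induction p with
    | nil => simp
    | cons hadj p ih =>
      have := sub_le_of_adj_of_subharmonic G hD hmin hsub hadj
      rw [SimpleGraph.Walk.length_cons]
      push_cast
      linarith
  obtain ⟨p⟩ := hG.preconnected x y
  have hlen : p.toPath.1.length ≤ Fintype.card V - 1 := by
    have := p.toPath.2.length_lt
    omega
  have hlen' : (p.toPath.1.length : ℝ) ≤ ((Fintype.card V - 1 : ℕ) : ℝ) := by exact_mod_cast hlen
  calc h x = h x - h y := by rw [hy, sub_zero]
    _ ≤ p.toPath.1.length * (((Fintype.card V - 1 : ℕ) : ℝ) * D) := walk _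
    _ ≤ ((Fintype.card V - 1 : ℕ) : ℝ) * (((Fintype.card V - 1 : ℕ) : ℝ) * D) := by gcongr
    _ = _ := by ring

/-! ### Avoidance events and the Markov property -/

/-- The set of trajectories that avoid `y` up to and including time `n`. -/
def avoids {V : Type*} (y : V) (n : ℕ) : Set (ℕ → V) := {ω | ∀ i ≤ n, ω i ≠ y}

theorem firstVisit_le_tsum {V : Type*} (y : V) (ω : ℕ → V) :
    (firstVisit y ω : ℝ≥0∞) ≤ ∑' n, (avoids y n).indicator 1 ω := by
  classical
  by_cases hex : ∃ j, ω j = y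
  · have hT : firstVisit y ω = ((Nat.find hex : ℕ) : ℕ∞) := by
      have hex' : ∃ j, 0 ≤ j ∧ ω j ∈ ({y} : Set V) := by simpa using hex
      have hset : {i : ℕ | 0 ≤ i ∧ ω i ∈ ({y} : Set V)} = {i | ω i = y} := by ext; simp
      rw [firstVisit, hittingAfter_def]
      simp only [if_pos hex', hset]
      exact congrArg _ (Nat.sInf_def (s := {i | ω i = y}) hex)
    rw [hT, ENat.toENNReal_coe]
    calc ((Nat.find hex : ℕ) : ℝ≥0∞)
        = ∑ n ∈ Finset.range (Nat.find hex), (avoids y n).indicator (1 : (ℕ → V) → ℝ≥0∞) ω := by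
          rw [Finset.sum_congr rfl (g := fun _ => 1)]
          · simp
          · intro n hn
            refine Set.indicator_of_mem (f := (1 : (ℕ → V) → ℝ≥0∞)) ?_
            exact fun i hi => Nat.find_min hex (hi.trans_lt (Finset.mem_range.1 hn))
      _ ≤ _ := ENNReal.sum_le_tsum _
  · have : ∀ n, (avoids y n).indicator (1 : (ℕ → V) → ℝ≥0∞) ω = 1 := fun n =>
      Set.indicator_of_mem (f := (1 : (ℕ → V) → ℝ≥0∞))
        (show ω ∈ avoids y n from fun i _ hi => hex ⟨i, hi⟩)
    simp [this]

theorem measurableSet_avoids {V : Type*} [MeasurableSpace V] [MeasurableSingletonClass V]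
    (y : V) (n : ℕ) : MeasurableSet (avoids y n) := by
  have : avoids y n = ⋂ i, ⋂ _ : i ≤ n, (fun ω : ℕ → V => ω i) ⁻¹' {y}ᶜ := by
    ext ω; simp [avoids]
  rw [this]
  exact MeasurableSet.iInter fun i => MeasurableSet.iInter fun _ =>
    measurable_pi_apply i (measurableSet_singleton y).compl

variable {V : Type*} [Fintype V] (G : SimpleGraph V) [DecidableRel G.Adj]
  [MeasurableSpace V] [MeasurableSingletonClass V]

/-- Multiplying by the degree removes the division and makes the absorbing isolated vertex harmless.
-/
theorem degree_mul_lintegral_stepKernel (v : V) (g : V → ℝ≥0∞) :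
    G.degree v * ∫⁻ w, g w ∂(stepKernel G v) = ∑ w ∈ G.neighborFinset v, g w := by
  classical
  have hlint : ∫⁻ w, g w ∂(stepKernel G v) = ∑ w, g w * stepPMF G v w := by
    change ∫⁻ w, g w ∂(stepPMF G v).toMeasure = _
    rw [lintegral_fintype]
    refine Finset.sum_congr rfl fun w _ => ?_
    rw [PMF.toMeasure_apply_singleton _ _ (measurableSet_singleton w)]
  by_cases hne : (G.neighborFinset v).Nonempty
  · have hd : (G.degree v : ℝ≥0∞) ≠ 0 := by
      rw [← SimpleGraph.card_neighborFinset_eq_degree]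
      exact_mod_cast hne.card_pos.ne'
    have hstep : ∀ w, g w * stepPMF G v w =
        if w ∈ G.neighborFinset v then g w * (G.degree v : ℝ≥0∞)⁻¹ else 0 := by
      intro w
      rw [stepPMF, dif_pos hne, PMF.uniformOfFinset_apply,
        SimpleGraph.card_neighborFinset_eq_degree, mul_ite, mul_zero]
    rw [hlint, Finset.sum_congr rfl fun w _ => hstep w, Finset.sum_ite_mem, Finset.univ_inter,
      ← Finset.sum_mul, mul_comm, mul_assoc,
      ENNReal.inv_mul_cancel hd (ENNReal.natCast_ne_top _), mul_one]
  · have hemp := Finset.not_nonempty_iff_eq_empty.1 hne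
    have hd : G.degree v = 0 := by
      rw [← SimpleGraph.card_neighborFinset_eq_degree, hemp, Finset.card_empty]
    simp [hd, hemp]

/-- The Markov property of the walk for a function of the past and of the next position. -/
theorem lintegral_walkLaw_mul_succ (x : V) (n : ℕ) (F : (Π _ : Finset.Iic n, V) → ℝ≥0∞)
    (g : V → ℝ≥0∞) :
    ∫⁻ ω, F (Preorder.frestrictLe n ω) * g (ω (n + 1)) ∂(walkLaw G x) =
      ∫⁻ ω, F (Preorder.frestrictLe n ω) * ∫⁻ w, g w ∂(stepKernel G (ω n)) ∂(walkLaw G x) := by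
  have hF : Measurable F := measurable_of_countable F
  have hg : Measurable g := measurable_of_countable g
  have hk : Measurable fun h : (Π _ : Finset.Iic n, V) =>
      F h * ∫⁻ w, g w ∂(historyKernel G n h) := measurable_of_countable _
  have hlaw := Kernel.partialTraj_compProd_eq_map_traj (X := fun _ => V)
    (κ := historyKernel G) (Nat.zero_le n) (x₀ := fun _ => x)
  have hmap := Kernel.traj_map_frestrictLe_apply (X := fun _ => V)
    (κ := historyKernel G) 0 n (fun _ => x)
  have hFg : Measurable fun p : (Π _ : Finset.Iic n, V) × V => F p.1 * g p.2 := by fun_prop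
  calc ∫⁻ ω, F (Preorder.frestrictLe n ω) * g (ω (n + 1)) ∂(walkLaw G x)
      = ∫⁻ p, F p.1 * g p.2 ∂((walkLaw G x).map
          fun ω => (Preorder.frestrictLe n ω, ω (n + 1))) := by
        rw [lintegral_map hFg (by fun_prop)]
    _ = ∫⁻ h, F h * ∫⁻ w, g w ∂(historyKernel G n h)
          ∂((walkLaw G x).map (Preorder.frestrictLe n)) := by
        rw [walkLaw, ← hlaw, Measure.lintegral_compProd hFg, hmap]
        simp_rw [lintegral_const_mul _ hg]
    _ = _ := by
        rw [lintegral_map hk (by fun_prop)]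
        rfl

/-- The probability that the walk started at `v` avoids `y` up to and including time `n`, defined
by conditioning on the first step. -/
noncomputable def survival (y : V) : ℕ → V → ℝ≥0∞
  | 0 => ({y}ᶜ : Set V).indicator 1
  | n + 1 => ({y}ᶜ : Set V).indicator fun v => ∫⁻ w, survival y n w ∂(stepKernel G v)

theorem survival_self (y : V) (n : ℕ) : survival G y n y = 0 := by
  cases n <;> simp [survival]

theorem survival_succ_of_ne {y v : V} (hv : v ≠ y) (n : ℕ) :
    survival G y (n + 1) v = ∫⁻ w, survival G y n w ∂(stepKernel G v) := by
  simp [survival, hv]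

theorem survival_le_one (y : V) (n : ℕ) (v : V) : survival G y n v ≤ 1 := by
  induction n generalizing v with
  | zero => exact Set.indicator_le_self' (fun _ _ => zero_le) v
  | succ n ih =>
    by_cases hv : v = y
    · subst hv; simp [survival_self]
    · rw [survival_succ_of_ne G hv]
      exact (lintegral_mono ih).trans (by simp)

/-- `survival` vanishes at `y`, so avoidance at time `n + 1` comes for free; the first factor then
depends on the past only, as the Markov property requires. -/
theorem indicator_avoids_mul_survival_succ (y : V) (n k : ℕ) (ω : ℕ → V) :
    {h : Π _ : Finset.Iic n, V | ∀ i, h i ≠ y}.indicator (1 : (Π _ : Finset.Iic n, V) → ℝ≥0∞)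
        (Preorder.frestrictLe n ω) * survival G y k (ω (n + 1)) =
      (avoids y (n + 1)).indicator 1 ω * survival G y k (ω (n + 1)) := by
  classical
  by_cases hy : ω (n + 1) = y
  · simp [hy, survival_self]
  · congr 1
    simp only [Set.indicator_apply, avoids, Set.mem_ofPred_eq, Pi.one_apply]
    refine if_congr ⟨fun hω i hi => ?_, fun hω i => ?_⟩ rfl rfl
    · rcases Nat.le_succ_iff.1 hi with hi | rfl
      · exact hω ⟨i, Finset.mem_Iic.2 hi⟩
      · exact hy
    · exact hω i ((Finset.mem_Iic.1 i.2).trans n.le_succ)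

theorem lintegral_avoids_mul_survival_succ (x y : V) (n k : ℕ) :
    ∫⁻ ω, (avoids y n).indicator 1 ω * survival G y (k + 1) (ω n) ∂(walkLaw G x) =
      ∫⁻ ω, (avoids y (n + 1)).indicator 1 ω * survival G y k (ω (n + 1)) ∂(walkLaw G x) := by
  classical
  simp_rw [← indicator_avoids_mul_survival_succ]
  rw [lintegral_walkLaw_mul_succ]
  refine lintegral_congr fun ω => ?_
  by_cases hω : ω ∈ avoids y n
  · have h1 : Preorder.frestrictLe (π := fun _ => V) n ω ∈
        {h : Π _ : Finset.Iic n, V | ∀ i, h i ≠ y} := fun i => hω i (Finset.mem_Iic.1 i.2)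
    rw [Set.indicator_of_mem hω, Set.indicator_of_mem h1, survival_succ_of_ne G (hω n le_rfl)]
    rfl
  · have h1 : Preorder.frestrictLe (π := fun _ => V) n ω ∉
        {h : Π _ : Finset.Iic n, V | ∀ i, h i ≠ y} :=
      fun h => hω fun i hi => h ⟨i, Finset.mem_Iic.2 hi⟩
    rw [Set.indicator_of_notMem hω, Set.indicator_of_notMem h1, zero_mul, zero_mul]

theorem walkLaw_zero_ae (x : V) : ∀ᵐ ω ∂(walkLaw G x), ω 0 = x := by
  have hmap := Kernel.traj_map_frestrictLe_apply (X := fun _ => V)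
    (κ := historyKernel G) 0 0 (fun _ => x)
  rw [Kernel.partialTraj_self, Kernel.id_apply] at hmap
  have hm : Measurable (Preorder.frestrictLe (π := fun _ : ℕ => V) 0) := by fun_prop
  have h0 : ∀ᵐ h ∂((walkLaw G x).map (Preorder.frestrictLe (π := fun _ : ℕ => V) 0)),
      h ⟨0, Finset.mem_Iic.2 le_rfl⟩ = x := by
    rw [walkLaw, hmap]
    exact (ae_dirac_iff (measurableSet_eq_fun (measurable_pi_apply _) measurable_const)).2 rfl
  exact ae_of_ae_map hm.aemeasurable h0

instance (x : V) : IsProbabilityMeasure (walkLaw G x) := by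
  unfold walkLaw; infer_instance

theorem walkLaw_avoids (x y : V) (N : ℕ) : walkLaw G x (avoids y N) = survival G y N x := by
  classical
  -- Each Markov step trades one unit of survival time for one more step of actual avoidance.
  have chain : ∀ n k, ∫⁻ ω, (avoids y 0).indicator 1 ω * survival G y (n + k) (ω 0) ∂(walkLaw G x)
      = ∫⁻ ω, (avoids y n).indicator 1 ω * survival G y k (ω n) ∂(walkLaw G x) := by
    intro n
    induction n with
    | zero => intro k; rw [zero_add]
    | succ n ih =>
      intro k
      rw [← lintegral_avoids_mul_survival_succ, ← ih (k + 1), add_right_comm, add_assoc]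
  have last : ∀ ω : ℕ → V, (avoids y N).indicator (1 : (ℕ → V) → ℝ≥0∞) ω * survival G y 0 (ω N) =
      (avoids y N).indicator 1 ω := by
    intro ω
    by_cases hω : ω ∈ avoids y N
    · have : ω N ≠ y := hω N le_rfl
      simp [survival, this]
    · simp [hω]
  have first : ∀ ω : ℕ → V,
      (avoids y 0).indicator (1 : (ℕ → V) → ℝ≥0∞) ω * survival G y N (ω 0) = survival G y N (ω 0) := by
    intro ω
    by_cases hω : ω 0 = y
    · simp [hω, survival_self]
    · have : ω ∈ avoids y 0 := fun i hi => by rwa [Nat.le_zero.1 hi]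
      simp [this]
  have key := chain N 0
  simp_rw [add_zero, last, first] at key
  rw [lintegral_indicator_one (measurableSet_avoids y N)] at key
  rw [← key, lintegral_congr_ae ((walkLaw_zero_ae G x).mono fun ω hω => by
    rw [hω])]
  simp

/-! ### Truncated hitting times and the bound -/

theorem hittingTime_le_tsum_survival (x y : V) :
    hittingTime G x y ≤ ∑' n, survival G y n x := by
  calc hittingTime G x y ≤ ∫⁻ ω, ∑' n, (avoids y n).indicator 1 ω ∂(walkLaw G x) :=
        lintegral_mono fun ω => firstVisit_le_tsum y ω
    _ = ∑' n, ∫⁻ ω, (avoids y n).indicator 1 ω ∂(walkLaw G x) :=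
        lintegral_tsum fun n =>
          (measurable_one.indicator (measurableSet_avoids y n)).aemeasurable
    _ = _ := by
        simp_rw [lintegral_indicator_one (measurableSet_avoids y _), walkLaw_avoids]

theorem degree_mul_sum_survival_le {y v : V} (hv : v ≠ y) (N : ℕ) :
    G.degree v * ∑ n ∈ Finset.range N, survival G y n v ≤
      G.degree v + ∑ w ∈ G.neighborFinset v, ∑ n ∈ Finset.range N, survival G y n w := by
  calc G.degree v * ∑ n ∈ Finset.range N, survival G y n v
      ≤ G.degree v * ∑ n ∈ Finset.range (N + 1), survival G y n v := by
        -- The extra term lets the sum split into its time-zero term, at most 1, and `N` terms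
        -- shifted by one step.
        gcongr; exact N.le_succ
    _ = G.degree v * survival G y 0 v +
          ∑ n ∈ Finset.range N, ∑ w ∈ G.neighborFinset v, survival G y n w := by
        rw [Finset.sum_range_succ', mul_add, add_comm, Finset.mul_sum]
        simp_rw [survival_succ_of_ne G hv, degree_mul_lintegral_stepKernel]
    _ ≤ _ := by
        rw [Finset.sum_comm]
        gcongr
        exact (mul_le_mul_right (survival_le_one G y 0 v) _).trans_eq (mul_one _)

theorem hittingTime_le_of_degree_le (hG : G.Connected) {D : ℕ} (hD : ∀ v, G.degree v ≤ D)
    (x y : V) : hittingTime G x y ≤ ((D * (Fintype.card V - 1) ^ 2 : ℕ) : ℝ≥0∞) := by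
  refine (hittingTime_le_tsum_survival G x y).trans ?_
  rw [ENNReal.tsum_eq_iSup_nat]
  refine iSup_le fun N => ?_
  have hfin : ∀ v, ∑ n ∈ Finset.range N, survival G y n v ≠ ∞ := fun v =>
    ENNReal.sum_ne_top.2 fun n _ => ((survival_le_one G y n v).trans_lt ENNReal.one_lt_top).ne
  have bound := le_of_subharmonic G hG hD (y := y)
    (h := fun v => (∑ n ∈ Finset.range N, survival G y n v).toReal)
    (by simp [survival_self]) (fun v => ENNReal.toReal_nonneg) (fun v hv => by
      have hle := ENNReal.toReal_mono
        (ENNReal.add_ne_top.2 ⟨ENNReal.natCast_ne_top _, ENNReal.sum_ne_top.2 fun w _ => hfin w⟩)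
        (degree_mul_sum_survival_le G hv N)
      rwa [ENNReal.toReal_mul, ENNReal.toReal_add (ENNReal.natCast_ne_top _)
        (ENNReal.sum_ne_top.2 fun w _ => hfin w), ENNReal.toReal_sum fun w _ => hfin w,
        ENNReal.toReal_natCast] at hle) x
  rw [← ENNReal.ofReal_toReal (hfin x), ← ENNReal.ofReal_natCast]
  exact ENNReal.ofReal_le_ofReal (by exact_mod_cast bound)

end GraphWalk

theorem corollary2p8 {V : Type*} [Fintype V] [MeasurableSpace V] [MeasurableSingletonClass V]
    (G : SimpleGraph V) [DecidableRel G.Adj] (hG : G.Connected) (n : ℕ)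
    (hn : Fintype.card V = n) (x y : V) :
    GraphWalk.hittingTime G x y ≤ ((G.maxDegree * (n - 1) ^ 2 : ℕ) : ℝ≥0∞) ∧
    GraphWalk.hittingTime G x y ≤ (((n - 1) ^ 3 : ℕ) : ℝ≥0∞) ∧
    ∀ k : ℝ≥0, (∀ v : V, (G.degree v : ℝ≥0) ≤ k) →
      GraphWalk.hittingTime G x y ≤ (k : ℝ≥0∞) * ((n - 1 : ℕ) : ℝ≥0∞) ^ 2 := by
  subst hn
  have hmax := GraphWalk.hittingTime_le_of_degree_le G hG G.degree_le_maxDegree x y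
  refine ⟨hmax, ?_, fun k hk => ?_⟩
  · have hcard := GraphWalk.hittingTime_le_of_degree_le G hG
      (D := Fintype.card V - 1) (fun v => Nat.le_sub_one_of_lt (G.degree_lt_card_verts v)) x y
    rwa [← pow_succ'] at hcard
  · have : Nonempty V := ⟨x⟩
    obtain ⟨v, hv⟩ := G.exists_maximal_degree_vertex
    have hk' : (G.maxDegree : ℝ≥0∞) ≤ k := by
      rw [hv]
      exact_mod_cast hk v
    refine hmax.trans ?_
    push_cast
    gcongr
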